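/- **Theorem 1.2.** Let $k$ be an algebraically closed field and let $A=\bigoplus_{n\ge 0}A_n$ be a finitely generated graded $k$-algebra with $A_0=k$ (not necessarily generated in degree one) that is an integral domain of Krull dimension $2$. Assume: 1. $A$ has a Noether normalization $T=k[X_1,X_2]$ with $X_1,X_2\in A$ homogeneous of the same degree $m$; that is, $X_1,X_2\in A_m$ are algebraically independent over $k$ and $A$ is a finitely generated $T$-module. 2. For every nonzero $\xi\in T_m=T\cap A_m$, the $A$-module $A/\xi A$ has exactly one associated prime of height one. Let $R$ be a graded subring of $A$ (that is, $R=\bigoplus_{n\ge 0}(R\cap A_n)$) with $T\subseteq R\subseteq A$. Then the first Chow group $A_1(R)$ is a torsion group. Here, for $i\ge 0$, $Z_i(R)$ is the free abelian group with basis the symbols $[R/P]$, where $P$ runs over the primes of $R$ with $\dim R/P=i$. For a finitely generated $R$-module $M$ with $\dim M\le i$ one sets $[M]_i=\sum_{\dim R/P=i}\operatorname{length}_{R_P}(M_P)\,[R/P]$, and for a prime $Q$ of $R$ with $\dim R/Q=i+1$ and $x\in R\setminus Q$ one sets $\operatorname{div}(Q,x)=[(R/Q)/x(R/Q)]_i$.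 The group $A_i(R)$ is the quotient of $Z_i(R)$ by the subgroup generated by all such $\operatorname{div}(Q,x)$ (not only the homogeneous ones). -/

import Mathlib

/-- The prime ideals `P` of `R` with `dim R/P = i`; they index the basis `[R/P]` of the group of
`i`-dimensional cycles. -/
abbrev PrimesOfDim (R : Type*) [CommRing R] (i : ℕ) : Type _ :=
  {P : PrimeSpectrum R // ringKrullDim (R ⧸ P.asIdeal) = i}

/-- `Z_i(R)`: the free abelian group with basis the primes `P` of `R` with `dim R/P = i`. -/
abbrev Cycles (R : Type*) [CommRing R] (i : ℕ) : Type _ :=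
  PrimesOfDim R i →₀ ℤ

/-- The length of the localized module `M_P` over the local ring `R_P`. -/
noncomputable def localLength (R : Type*) [CommRing R] (M : Type*) [AddCommGroup M] [Module R M]
    (P : PrimeSpectrum R) : ℕ∞ :=
  Module.length (Localization P.asIdeal.primeCompl) (LocalizedModule P.asIdeal.primeCompl M)

/-- `z` is the cycle `[M]_i = ∑_{dim R/P = i} length(M_P) [R/P]`. For a finitely generated module
`M` of dimension at most `i` over a Noetherian ring there is exactly one such `z`
(see `existsUnique_isCycleOf`). -/
def IsCycleOf (R : Type*) [CommRing R] (i : ℕ) (M : Type*) [AddCommGroup M] [Module R M]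
    (z : Cycles R i) : Prop :=
  ∀ P : PrimesOfDim R i, ∃ n : ℕ, localLength R M P.1 = n ∧ z P = n

/-- `z` is the cycle `div(Q, x) = [(R/Q)/x(R/Q)]_i`; here `(R/Q)/x(R/Q)` is written `R/(Q + xR)`. -/
def IsDiv (R : Type*) [CommRing R] (i : ℕ) (Q : Ideal R) (x : R) (z : Cycles R i) : Prop :=
  IsCycleOf R i (R ⧸ (Q ⊔ Ideal.span {x})) z

/-- Cutting `R/Q` by an element outside the prime `Q` lowers the dimension. -/
theorem ringKrullDim_quotient_add_one_le (R : Type*) [CommRing R] (Q J : Ideal R) [Q.IsPrime]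
    (x : R) (hx : x ∉ Q) (hQJ : Q ≤ J) (hxJ : x ∈ J) :
    ringKrullDim (R ⧸ J) + 1 ≤ ringKrullDim (R ⧸ Q) := by
  have hx' : Ideal.Quotient.mk Q x ∈ nonZeroDivisors (R ⧸ Q) :=
    mem_nonZeroDivisors_of_ne_zero (by rwa [Ne, Ideal.Quotient.eq_zero_iff_mem])
  refine le_trans ?_ (ringKrullDim_quotient_succ_le_of_nonZeroDivisor hx')
  gcongr
  let f : (R ⧸ Q) ⧸ Ideal.span {Ideal.Quotient.mk Q x} →+* R ⧸ J :=
    Ideal.Quotient.lift _ (Ideal.Quotient.factor hQJ) (by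
      intro a ha
      obtain ⟨b, rfl⟩ := Ideal.mem_span_singleton'.1 ha
      rw [map_mul]
      have : Ideal.Quotient.factor hQJ (Ideal.Quotient.mk Q x) = 0 := by
        simpa [Ideal.Quotient.eq_zero_iff_mem] using hxJ
      rw [this, mul_zero])
  refine ringKrullDim_le_of_surjective f ?_
  apply Ideal.Quotient.lift_surjective_of_surjective
  exact Ideal.Quotient.factor_surjective hQJ

/-- If `dim M ≤ i`, the primes `P` of the support of `M` with `dim R/P = i` are minimal over the
annihilator of `M`. -/
theorem mem_minimalPrimes_annihilator (R : Type*) [CommRing R] (M : Type*) [AddCommGroup M]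
    [Module R M] [Module.Finite R M] (i : ℕ) (hM : Module.supportDim R M ≤ i)
    (P : PrimesOfDim R i) (hP : P.1 ∈ Module.support R M) :
    P.1.asIdeal ∈ (Module.annihilator R M).minimalPrimes := by
  refine ⟨⟨P.1.2, Module.mem_support_iff_of_finite.1 hP⟩, fun Q hQ hQP => ?_⟩
  by_contra hPQ
  obtain ⟨x, hxP, hxQ⟩ := SetLike.not_le_iff_exists.1 hPQ
  have := hQ.1
  have h1 := ringKrullDim_quotient_add_one_le R Q P.1.asIdeal x hxQ hQP hxP
  have h2 : ringKrullDim (R ⧸ Q) ≤ i := by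
    refine le_trans ?_ hM
    rw [Module.supportDim_eq_ringKrullDim_quotient_annihilator]
    exact ringKrullDim_le_of_surjective _ (Ideal.Quotient.factor_surjective hQ.2)
  rw [P.2] at h1
  have h3 := h1.trans h2
  norm_cast at h3
  omega

/-- `M_P` has finite length when `P` is minimal over the annihilator of `M`. -/
theorem localLength_ne_top (R : Type*) [CommRing R] [IsNoetherianRing R] (M : Type*)
    [AddCommGroup M] [Module R M] [Module.Finite R M] (P : PrimeSpectrum R)
    (hP : P.asIdeal ∈ (Module.annihilator R M).minimalPrimes) :
    localLength R M P ≠ ⊤ := by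
  let S := Localization P.asIdeal.primeCompl
  let N := LocalizedModule P.asIdeal.primeCompl M
  change Module.length S N ≠ ⊤
  have : IsLocalRing S := IsLocalization.AtPrime.isLocalRing S P.asIdeal
  have hS : IsNoetherianRing S := IsLocalization.isNoetherianRing P.asIdeal.primeCompl S inferInstance
  have : Module.Finite S N := Module.Finite.of_isLocalizedModule P.asIdeal.primeCompl
    (LocalizedModule.mkLinearMap P.asIdeal.primeCompl M)
  let J : Ideal S := (Module.annihilator R M).map (algebraMap R S)
  have hrad : J.radical = IsLocalRing.maximalIdeal S :=
    (IsLocalization.AtPrime.radical_map_of_mem_minimalPrimes S P.asIdeal _ hP).trans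
      (IsLocalization.AtPrime.map_eq_maximalIdeal P.asIdeal S)
  have hmin : IsLocalRing.maximalIdeal S ∈ J.minimalPrimes := by
    refine ⟨⟨inferInstance, hrad ▸ Ideal.le_radical⟩, fun q hq _ => ?_⟩
    rw [← hrad]
    exact hq.1.radical_le_iff.2 hq.2
  have hart := IsLocalRing.quotient_artinian_of_mem_minimalPrimes_of_isLocalRing J hmin
  have hJ' : J ≤ Module.annihilator S N := by
    refine Ideal.map_le_iff_le_comap.2 fun r hr => ?_
    rw [Ideal.mem_comap, Module.mem_annihilator]
    intro n
    induction n using LocalizedModule.induction_on with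
    | h m s =>
      rw [algebraMap_smul, LocalizedModule.smul'_mk, Module.mem_annihilator.1 hr,
        LocalizedModule.zero_mk]
  have hJ : Module.IsTorsionBySet S N J := fun n a => Module.mem_annihilator.1 (hJ' a.2) n
  let _ := hJ.module
  have : IsScalarTower S (S ⧸ J) N := hJ.isScalarTower
  have : Module.Finite (S ⧸ J) N := Module.Finite.of_restrictScalars_finite S (S ⧸ J) N
  have : IsArtinian (S ⧸ J) N := inferInstance
  have : IsArtinian S N :=
    isArtinian_of_surjective_algebraMap (R := S ⧸ J) Ideal.Quotient.mk_surjective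
  exact Module.length_ne_top

/-- The cycle `[M]_i` of a finitely generated module of dimension at most `i` is well defined. -/
theorem existsUnique_isCycleOf (R : Type*) [CommRing R] [IsNoetherianRing R] (i : ℕ) (M : Type*)
    [AddCommGroup M] [Module R M] [Module.Finite R M] (hM : Module.supportDim R M ≤ i) :
    ∃! z : Cycles R i, IsCycleOf R i M z := by
  have hzero (P : PrimesOfDim R i) (hP : P.1 ∉ Module.support R M) : localLength R M P.1 = 0 := by
    rw [Module.notMem_support_iff] at hP
    exact Module.length_eq_zero
  have hfin : {P : PrimesOfDim R i | P.1 ∈ Module.support R M}.Finite := by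
    refine Set.Finite.of_finite_image (f := fun P : PrimesOfDim R i => P.1.asIdeal)
      (((Module.annihilator R M).finite_minimalPrimes_of_isNoetherianRing R).subset ?_) ?_
    · rintro _ ⟨P, hP, rfl⟩
      exact mem_minimalPrimes_annihilator R M i hM P hP
    · exact fun P _ Q _ h => Subtype.ext (PrimeSpectrum.ext h)
  refine ⟨Finsupp.ofSupportFinite (fun P => ((localLength R M P.1).toNat : ℤ))
    (hfin.subset fun P hP => ?_), fun P => ⟨(localLength R M P.1).toNat, ?_, rfl⟩, fun z hz => ?_⟩
  · by_contra h
    exact hP (by simp [hzero P h])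
  · refine (ENat.natCast_toNat ?_).symm
    by_cases hP : P.1 ∈ Module.support R M
    · exact localLength_ne_top R M P.1 (mem_minimalPrimes_annihilator R M i hM P hP)
    · simp [hzero P hP]
  · ext P
    obtain ⟨n, h1, h2⟩ := hz P
    rw [h2]
    change (n : ℤ) = ((localLength R M P.1).toNat : ℤ)
    simp [h1]

/-- The cycle `div(Q, x)` is well defined. -/
theorem existsUnique_isDiv (R : Type*) [CommRing R] [IsNoetherianRing R] (i : ℕ)
    (Q : PrimesOfDim R (i + 1)) (x : R) (hx : x ∉ Q.1.asIdeal) :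
    ∃! z : Cycles R i, IsDiv R i Q.1.asIdeal x z := by
  refine existsUnique_isCycleOf R i _ ?_
  rw [Module.supportDim_quotient_eq_ringKrullDim]
  have h := ringKrullDim_quotient_add_one_le R Q.1.asIdeal (Q.1.asIdeal ⊔ Ideal.span {x}) x hx
    le_sup_left (Ideal.mem_sup_right (Ideal.mem_span_singleton_self x))
  rw [Q.2] at h
  push_cast at h
  exact (ENat.WithBot.add_le_add_one_right_iff).1 h

/-- The `i`-cycles rationally equivalent to zero: the subgroup of `Z_i(R)` generated by the
`div(Q, x)`, for `Q` a prime with `dim R/Q = i + 1` and `x ∉ Q`. -/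
noncomputable def rationallyTrivial (R : Type*) [CommRing R] (i : ℕ) : AddSubgroup (Cycles R i) :=
  AddSubgroup.closure
    {z | ∃ (Q : PrimesOfDim R (i + 1)) (x : R), x ∉ Q.1.asIdeal ∧ IsDiv R i Q.1.asIdeal x z}

/-- The Chow group `A_i(R)` of an affine algebra `R`: cycles of dimension `i` modulo rational
equivalence. -/
abbrev ChowGroup (R : Type*) [CommRing R] (i : ℕ) : Type _ :=
  Cycles R i ⧸ rationallyTrivial R i

/-- `Ass^{(i)}_R(M)`: the associated primes of `M` of height `i`. -/
def assOfHeight (R : Type*) [CommRing R] (M : Type*) [AddCommGroup M] [Module R M] (i : ℕ) :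
    Set (Ideal R) :=
  {P | P ∈ associatedPrimes R M ∧ P.height = i}

/-!
The ring `R` is Noetherian and `A` is integral over it, so `R` is a two-dimensional domain and every
nonzero `x : R` gives a relation `div(0, x) = 0` in `A_1(R)`, in which exactly the one-dimensional
primes containing `x` occur, each with a positive coefficient. Hence `[R/P]` is torsion as soon as
some nonzero `x ∈ P` is such that all other one-dimensional primes containing `x` have torsion
class (`isOfFinAddOrder_single_of_mem_div`). The one-dimensional primes are of two kinds.

*Primes containing a nonzero homogeneous element.* A prime `Q` of `A` over `P` contains a nonzero
homogeneous element of `T = k[X₁, X₂]`. As `k` is algebraically closed, a binary form that vanishes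
in the domain `A/Q` forces a linear relation between the images of `X₁` and `X₂`, so `Q` contains
a nonzero `ξ ∈ T_m` (`exists_linear_form_mem`). The primes of `A` over one-dimensional primes of `R`
containing `ξ` are associated primes of `A/ξA` of height one (`mem_assOfHeight_of_comap`), so by
hypothesis there is only one of them, and `P` is the only one-dimensional prime of `R` containing
`ξ`.

*Primes without nonzero homogeneous elements.* Inverting the nonzero homogeneous elements of `R`
would give a ring in which ideals are generated by elements of minimal spread of degrees, as in
`K[t, t⁻¹]`. Pseudo-division gives the consequence that is needed without localizing: if `f ∈ P` is
nonzero with minimal spread of degrees, then every prime containing `f` and no nonzero homogeneous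
element contains `P` (`exists_mem_forall_prime_le`). So all one-dimensional primes other than `P`
in `div(0, f)` are of the first kind.
-/

/-! ### Krull dimension of integral extensions -/

/-- In an integral extension a chain of primes below `P` lifts, by going up, to a chain of the same
length. -/
theorem exists_comap_eq_and_le_height {R S : Type*} [CommRing R] [CommRing S] [Algebra R S]
    [Algebra.IsIntegral R S] (hinj : Function.Injective (algebraMap R S)) (n : ℕ)
    (P : PrimeSpectrum R) (hP : (n : ℕ∞) ≤ Order.height P) :
    ∃ Q : PrimeSpectrum S, Q.asIdeal.comap (algebraMap R S) = P.asIdeal ∧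
      (n : ℕ∞) ≤ Order.height Q := by
  induction n generalizing P with
  | zero =>
    obtain ⟨Q, -, hQ, hQP⟩ := Ideal.exists_ideal_over_prime_of_isIntegral P.asIdeal (⊥ : Ideal S)
      (by rw [Ideal.comap_bot_of_injective _ hinj]; exact bot_le)
    exact ⟨⟨Q, hQ⟩, hQP, by simp⟩
  | succ n ih =>
    obtain ⟨l, rfl, hl⟩ := Order.exists_series_of_le_height P hP
    have hlt : l.eraseLast.last < l.last := l.eraseLast_last_rel_last (by omega)
    obtain ⟨Q', hQ', hnQ'⟩ := ih l.eraseLast.last <| by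
      refine le_trans ?_ Order.length_le_height_last
      simp [hl]
    obtain ⟨Q, hQQ', hQ, hQP⟩ := Ideal.exists_ideal_over_prime_of_isIntegral l.last.asIdeal
      Q'.asIdeal (hQ'.le.trans hlt.le)
    refine ⟨⟨Q, hQ⟩, hQP, ?_⟩
    have hlt' : Q' < ⟨Q, hQ⟩ := by
      refine lt_of_le_of_ne hQQ' ?_
      rintro rfl
      exact hlt.ne (PrimeSpectrum.ext (hQ'.symm.trans hQP))
    push_cast
    exact le_trans (by gcongr) (Order.height_add_one_le hlt')

theorem ringKrullDim_eq_of_isIntegral {R S : Type*} [CommRing R] [CommRing S] [Algebra R S]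
    [Algebra.IsIntegral R S] (hinj : Function.Injective (algebraMap R S)) :
    ringKrullDim R = ringKrullDim S := by
  refine le_antisymm ?_ (Order.krullDim_le_of_strictMono (PrimeSpectrum.comap (algebraMap R S))
    fun _ _ h => Ideal.IsIntegral.comap_lt_comap h)
  rw [ringKrullDim, ringKrullDim]
  refine iSup_le fun l => ?_
  obtain ⟨Q, -, hQ⟩ := exists_comap_eq_and_le_height hinj l.length l.last
    Order.length_le_height_last
  exact le_trans (by exact_mod_cast hQ) (Order.height_le_krullDim Q)

/-! ### Cycles and relations -/

/-- The primes that occur in `div(Q, x)` are those of the support of `R/(Q + xR)`. -/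
theorem IsDiv.apply_ne_zero_iff {R : Type*} [CommRing R] {i : ℕ} {Q : Ideal R} {x : R}
    {z : Cycles R i} (hz : IsDiv R i Q x z) (P : PrimesOfDim R i) :
    z P ≠ 0 ↔ Q ≤ P.1.asIdeal ∧ x ∈ P.1.asIdeal := by
  obtain ⟨n, hn, hzn⟩ := hz P
  have h : localLength R (R ⧸ (Q ⊔ Ideal.span {x})) P.1 = 0 ↔
      P.1 ∉ Module.support R (R ⧸ (Q ⊔ Ideal.span {x})) := by
    rw [localLength, Module.length_eq_zero_iff, Module.notMem_support_iff]
  rw [hn, Module.support_eq_zeroLocus, Ideal.annihilator_quotient, PrimeSpectrum.mem_zeroLocus,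
    SetLike.coe_subset_coe, sup_le_iff, Ideal.span_singleton_le_iff_mem] at h
  rw [hzn, Nat.cast_ne_zero, ← not_iff_not, not_not, ← h, Nat.cast_eq_zero]

/-- The map sending a cycle to its class modulo rational equivalence. -/
noncomputable def cycleClass (R : Type*) [CommRing R] (i : ℕ) : Cycles R i →+ ChowGroup R i :=
  QuotientAddGroup.mk' (rationallyTrivial R i)

theorem isOfFinAddOrder_cycleClass {R : Type*} [CommRing R] {i : ℕ} (z : Cycles R i)
    (h : ∀ P, z P ≠ 0 → IsOfFinAddOrder (cycleClass R i (Finsupp.single P 1))) :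
    IsOfFinAddOrder (cycleClass R i z) := by
  change cycleClass R i z ∈ AddCommGroup.torsion _
  rw [← Finsupp.sum_single z, Finsupp.sum, map_sum]
  refine sum_mem fun P hP => ?_
  rw [← Finsupp.smul_single_one, map_zsmul]
  exact zsmul_mem (h P (Finsupp.mem_support_iff.1 hP)) _

/-- The relation `div(Q, x) = 0` expresses a positive multiple of `[R/P]` through the classes of the
other primes occurring in it. -/
theorem isOfFinAddOrder_single_of_mem_div {R : Type*} [CommRing R] [IsNoetherianRing R] {i : ℕ}
    (Q : PrimesOfDim R (i + 1)) (x : R) (hx : x ∉ Q.1.asIdeal) (P : PrimesOfDim R i)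
    (hQP : Q.1.asIdeal ≤ P.1.asIdeal) (hxP : x ∈ P.1.asIdeal)
    (h : ∀ P' : PrimesOfDim R i, P' ≠ P → Q.1.asIdeal ≤ P'.1.asIdeal → x ∈ P'.1.asIdeal →
      IsOfFinAddOrder (cycleClass R i (Finsupp.single P' 1))) :
    IsOfFinAddOrder (cycleClass R i (Finsupp.single P 1)) := by
  classical
  obtain ⟨z, hz, -⟩ := existsUnique_isDiv R i Q x hx
  have hz0 : cycleClass R i z = 0 :=
    (QuotientAddGroup.eq_zero_iff z).2 (AddSubgroup.subset_closure ⟨Q, x, hx, hz⟩)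
  have hrest : IsOfFinAddOrder (cycleClass R i (z.erase P)) := by
    refine isOfFinAddOrder_cycleClass _ fun P' hP' => ?_
    have hne : P' ≠ P := by
      rintro rfl
      simp at hP'
    rw [Finsupp.erase_ne hne, hz.apply_ne_zero_iff] at hP'
    exact h P' hne hP'.1 hP'.2
  have hsum : z P • cycleClass R i (Finsupp.single P 1) = -cycleClass R i (z.erase P) := by
    rw [eq_neg_iff_add_eq_zero, ← map_zsmul, Finsupp.smul_single_one, ← map_add,
      Finsupp.single_add_erase, hz0]
  have hn : z P ≠ 0 := (hz.apply_ne_zero_iff P).2 ⟨hQP, hxP⟩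
  obtain ⟨n, -, hzn⟩ := hz P
  rw [hzn, natCast_zsmul] at hsum
  rw [hzn, Nat.cast_ne_zero] at hn
  exact IsOfFinAddOrder.of_nsmul (hsum ▸ hrest.neg) hn

/-! ### Pseudo-division by an element of minimal spread of degrees -/

/-- Pseudo-division. Let `f ∈ P` have its components in degrees `a, …, a + n`, the top one `g` being
nonzero, and let no nonzero element of `P` be spread over fewer than `n + 1` consecutive degrees. If
`P'` is a prime containing `f` but no nonzero homogeneous element, then `P ≤ P'`: for `h ∈ P` with
top component `t`, the element `g * h - t * f` of `P` is less spread than `h`, so it is in `P'` by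
induction, and `g ∉ P'`. -/
theorem mem_of_minimal_spread {A : Type*} [CommRing A] {σ : Type*} [SetLike σ A]
    [AddSubgroupClass σ A] (𝒜 : ℕ → σ) [GradedRing 𝒜] (R : Subring A)
    (hR : DirectSum.SetLike.IsHomogeneous 𝒜 R) (P P' : Ideal R) [P'.IsPrime]
    (hP' : ∀ r ∈ P', ∀ i, (r : A) ∈ 𝒜 i → r = 0)
    (f : R) (hfP : f ∈ P) (hfP' : f ∈ P') (a n : ℕ)
    (hf : ∀ i, (DirectSum.decompose 𝒜 (f : A) i : A) ≠ 0 → a ≤ i ∧ i ≤ a + n)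
    (hfn : (DirectSum.decompose 𝒜 (f : A) (a + n) : A) ≠ 0)
    (hmin : ∀ h ∈ P, ∀ b,
      (∀ i, (DirectSum.decompose 𝒜 (h : A) i : A) ≠ 0 → b ≤ i ∧ i < b + n) → h = 0)
    (N : ℕ) (h : R) (hhP : h ∈ P) (b : ℕ)
    (hh : ∀ i, (DirectSum.decompose 𝒜 (h : A) i : A) ≠ 0 → b ≤ i ∧ i < b + N) : h ∈ P' := by
  induction N generalizing h b with
  | zero =>
    rw [hmin h hhP b fun i hi => ⟨(hh i hi).1, by have := hh i hi; omega⟩]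
    exact zero_mem _
  | succ N ih =>
    by_cases hN : N < n
    · rw [hmin h hhP b fun i hi => ⟨(hh i hi).1, by have := hh i hi; omega⟩]
      exact zero_mem _
    push Not at hN
    let g : R := ⟨DirectSum.decompose 𝒜 (f : A) (a + n), hR _ f.2⟩
    let t : R := ⟨DirectSum.decompose 𝒜 (h : A) (b + N), hR _ h.2⟩
    have hg : (g : A) ∈ 𝒜 (a + n) := SetLike.coe_mem _
    have ht : (t : A) ∈ 𝒜 (b + N) := SetLike.coe_mem _
    have key : g * h - t * f ∈ P' := by
      refine ih _ (sub_mem (P.mul_mem_left _ hhP) (P.mul_mem_left _ hfP)) (a + n + b) fun i hi => ?_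
      by_contra hcon
      apply hi
      push_cast
      rw [DirectSum.decompose_sub, DirectSum.sub_apply, AddSubgroupClass.coe_sub, sub_eq_zero]
      -- in the top degree the components of `g * h` and `t * f` are `g * t` and `t * g`
      by_cases hi : i = a + n + b + N
      · subst hi
        rw [show a + n + b + N = (a + n) + (b + N) by ring,
          DirectSum.coe_decompose_mul_add_of_left_mem 𝒜 hg, add_comm (a + n),
          DirectSum.coe_decompose_mul_add_of_left_mem 𝒜 ht, mul_comm]
      -- in the other degrees outside the range both components vanish; `n ≤ N` is used for `t * f`
      trans 0
      · by_cases hle : a + n ≤ i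
        · rw [DirectSum.coe_decompose_mul_of_left_mem_of_le 𝒜 hg hle]
          by_contra h0
          have := hh _ (right_ne_zero_of_mul h0)
          omega
        · exact DirectSum.coe_decompose_mul_of_left_mem_of_not_le 𝒜 hg hle
      · symm
        by_cases hle : b + N ≤ i
        · rw [DirectSum.coe_decompose_mul_of_left_mem_of_le 𝒜 ht hle]
          by_contra h0
          have := hf _ (right_ne_zero_of_mul h0)
          omega
        · exact DirectSum.coe_decompose_mul_of_left_mem_of_not_le 𝒜 ht hle
    have hgh : g * h ∈ P' := by
      simpa using add_mem key (P'.mul_mem_left t hfP')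
    refine (Ideal.IsPrime.mem_or_mem ‹_› hgh).resolve_left fun hgP' => hfn ?_
    exact congrArg Subtype.val (hP' g hgP' _ hg)

/-- An element `f` of `P` whose homogeneous components fill as few consecutive degrees as
possible lies in no prime without nonzero homogeneous elements except those containing `P`. -/
theorem exists_mem_forall_prime_le {A : Type*} [CommRing A] {σ : Type*} [SetLike σ A]
    [AddSubgroupClass σ A] (𝒜 : ℕ → σ) [GradedRing 𝒜] (R : Subring A)
    (hR : DirectSum.SetLike.IsHomogeneous 𝒜 R) (P : Ideal R) (hP : P ≠ ⊥) :
    ∃ f ∈ P, f ≠ 0 ∧ ∀ P' : Ideal R, P'.IsPrime → (∀ r ∈ P', ∀ i, (r : A) ∈ 𝒜 i → r = 0) →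
      f ∈ P' → P ≤ P' := by
  classical
  have hbound : ∀ h : R, ∃ N, ∀ i, (DirectSum.decompose 𝒜 (h : A) i : A) ≠ 0 → i < N := by
    intro h
    obtain ⟨N, hN⟩ := (DirectSum.decompose 𝒜 (h : A)).support.exists_nat_subset_range
    refine ⟨N, fun i hi => Finset.mem_range.1 (hN ?_)⟩
    rw [DFinsupp.mem_support_iff]
    exact fun h0 => hi (by rw [h0, ZeroMemClass.coe_zero])
  have hex : ∃ n, ∃ f ∈ P, f ≠ 0 ∧ ∃ a, ∀ i, (DirectSum.decompose 𝒜 (f : A) i : A) ≠ 0 →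
      a ≤ i ∧ i < a + n := by
    obtain ⟨f, hf, hf0⟩ := Submodule.exists_mem_ne_zero_of_ne_bot hP
    obtain ⟨N, hN⟩ := hbound f
    exact ⟨N, f, hf, hf0, 0, fun i hi => ⟨zero_le, by simpa using hN i hi⟩⟩
  have hmin : ∀ n < Nat.find hex, ∀ h ∈ P, ∀ b, (∀ i, (DirectSum.decompose 𝒜 (h : A) i : A) ≠ 0 →
      b ≤ i ∧ i < b + n) → h = 0 := by
    intro n hn h hh b hb
    by_contra h0
    exact Nat.find_min hex hn ⟨h, hh, h0, b, hb⟩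
  obtain ⟨f, hf, hf0, a, ha⟩ := Nat.find_spec hex
  have hpos : Nat.find hex ≠ 0 := by
    intro h
    rw [h] at ha
    apply hf0
    ext
    rw [← DirectSum.sum_support_decompose 𝒜 (f : A)]
    refine Finset.sum_eq_zero fun i _ => ?_
    by_contra hi
    have := ha i hi
    omega
  obtain ⟨n, hn⟩ := Nat.exists_eq_succ_of_ne_zero hpos
  rw [hn] at ha hmin
  refine ⟨f, hf, hf0, fun P' hP' hP'0 hfP' h hh => ?_⟩
  obtain ⟨N, hN⟩ := hbound h
  refine mem_of_minimal_spread 𝒜 R hR P P' hP'0 f hf hfP' a n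
    (fun i hi => by have := ha i hi; omega) (fun htop => hf0 ?_) (hmin n (by omega)) N h hh 0
    (fun i hi => ⟨zero_le, by simpa using hN i hi⟩)
  refine hmin n (by omega) f hf a fun i hi => ?_
  have := ha i hi
  have : i ≠ a + n := by
    rintro rfl
    exact hi htop
  omega

/-! ### Linear forms in homogeneous primes -/

/-- A binary form over an algebraically closed field is a product of linear forms, so one of them
vanishes where the form vanishes. In the proof, the quotient `x / y` is algebraic over `k`, hence
belongs to `k`. -/
theorem exists_linear_relation {k D : Type*} [Field k] [IsAlgClosed k] [CommRing D] [IsDomain D]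
    [Algebra k D] (x y : D) (p : MvPolynomial (Fin 2) k) (d : ℕ) (hp : p.IsHomogeneous d)
    (hp0 : p ≠ 0) (h : MvPolynomial.aeval ![x, y] p = 0) :
    ∃ a b : k, (a ≠ 0 ∨ b ≠ 0) ∧ a • x + b • y = 0 := by
  by_cases hy : y = 0
  · exact ⟨0, 1, by simp, by simp [hy]⟩
  let F := FractionRing D
  have hyF : algebraMap D F y ≠ 0 := by simpa using hy
  let u : F := algebraMap D F x / algebraMap D F y
  let q : Polynomial k := MvPolynomial.aeval ![Polynomial.X, 1] p
  -- a form is the homogenization of its dehomogenization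
  have hq0 : q ≠ 0 := by
    intro hq
    apply hp0
    rw [← Polynomial.homogenize_eq_of_isHomogeneous hp hq, Polynomial.homogenize_zero]
  have hqu : Polynomial.aeval u q = MvPolynomial.aeval ![u, 1] p := by
    rw [← AlgHom.comp_apply]
    congr 1
    ext i
    fin_cases i <;> simp
  -- homogeneity: `p(x, y) = y ^ d * p(x / y, 1)`
  have hscale : algebraMap D F y ^ d * MvPolynomial.aeval ![u, 1] p = 0 := by
    rw [← map_zero (algebraMap D F), ← h, ← MvPolynomial.aeval_algebraMap_apply,
      MvPolynomial.aeval_def, MvPolynomial.aeval_def, MvPolynomial.eval₂_eq',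
      MvPolynomial.eval₂_eq', Finset.mul_sum]
    refine Finset.sum_congr rfl fun e he => ?_
    have hed : e 0 + e 1 = d := by
      have := hp (MvPolynomial.mem_support_iff.1 he)
      simpa [Finsupp.weight_apply, Finsupp.sum_fintype] using this
    simp only [Fin.prod_univ_two, Function.comp_apply, Matrix.cons_val_zero, Matrix.cons_val_one,
      u, ← hed, one_pow, mul_one, div_pow, pow_add]
    have hcancel := div_mul_cancel₀ (algebraMap D F x ^ e 0) (pow_ne_zero (e 0) hyF)
    linear_combination (algebraMap k F (p.coeff e) * algebraMap D F y ^ e 1) * hcancel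
  have hu : IsAlgebraic k u :=
    ⟨q, hq0, hqu.trans ((mul_eq_zero.1 hscale).resolve_left (pow_ne_zero _ hyF))⟩
  obtain ⟨c, hc⟩ := minpoly.mem_range_of_degree_eq_one k u
    (IsAlgClosed.degree_eq_one_of_irreducible k (minpoly.irreducible hu.isIntegral))
  refine ⟨1, -c, by simp, IsFractionRing.injective D F ?_⟩
  have : algebraMap D F x = algebraMap k F c * algebraMap D F y := by
    rw [hc, div_mul_cancel₀ _ hyF]
  rw [map_add, one_smul, this, map_zero, Algebra.smul_def, map_mul,
    ← IsScalarTower.algebraMap_apply, map_neg]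
  ring

theorem aeval_homogeneousComponent {k A : Type*} [Field k] [CommRing A] [Algebra k A]
    (𝒜 : ℕ → Submodule k A) [GradedAlgebra 𝒜] {ι : Type*} {m : ℕ} (hm : m ≠ 0) (x : ι → A)
    (hx : ∀ i, x i ∈ 𝒜 m) (p : MvPolynomial ι k) (d : ℕ) :
    MvPolynomial.aeval x (MvPolynomial.homogeneousComponent d p) =
      DirectSum.decompose 𝒜 (MvPolynomial.aeval x p) (d * m) := by
  classical
  induction p using MvPolynomial.induction_on' with
  | add p q hp hq => simp [hp, hq]
  | monomial u a =>
    have hmem : MvPolynomial.aeval x (MvPolynomial.monomial u a) ∈ 𝒜 (u.degree * m) := by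
      rw [MvPolynomial.aeval_monomial, ← Algebra.smul_def, Finsupp.prod, Finsupp.degree_apply,
        Finset.sum_mul]
      refine Submodule.smul_mem _ _ (SetLike.prod_mem_graded _ _ _ fun i _ => ?_)
      simpa using SetLike.pow_mem_graded (u i) (hx i)
    rw [MvPolynomial.homogeneousComponent_of_mem (MvPolynomial.isHomogeneous_monomial a rfl)]
    split_ifs with h
    · rw [h, DirectSum.decompose_of_mem_same 𝒜 hmem]
    · rw [DirectSum.decompose_of_mem_ne 𝒜 hmem, map_zero]
      exact fun h' => h (Nat.eq_of_mul_eq_mul_right (Nat.pos_of_ne_zero hm) h').symm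

/-- A prime of `A` with a nonzero homogeneous element `r` contains a nonzero linear form in
`X₁, X₂`: since `A` is integral over `k[X₁, X₂]`, some multiple of `r` is a nonzero polynomial in
`X₁, X₂`, whose homogeneous components are multiples of `r` as well. -/
theorem exists_linear_form_mem {k A : Type*} [Field k] [IsAlgClosed k] [CommRing A] [IsDomain A]
    [Algebra k A] (𝒜 : ℕ → Submodule k A) [GradedAlgebra 𝒜] {m : ℕ} (hm : m ≠ 0) {X₁ X₂ : A}
    (hX₁ : X₁ ∈ 𝒜 m) (hX₂ : X₂ ∈ 𝒜 m) (halg : AlgebraicIndependent k ![X₁, X₂])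
    [Algebra.IsIntegral (Algebra.adjoin k {X₁, X₂}) A] (Q : Ideal A) [Q.IsPrime]
    {r : A} {e : ℕ} (hr : r ∈ 𝒜 e) (hr0 : r ≠ 0) (hrQ : r ∈ Q) :
    ∃ ξ ∈ Algebra.adjoin k {X₁, X₂}, ξ ∈ 𝒜 m ∧ ξ ≠ 0 ∧ ξ ∈ Q := by
  have hX : ∀ i, ![X₁, X₂] i ∈ 𝒜 m := by
    intro i
    fin_cases i <;> assumption
  have hrange : Set.range ![X₁, X₂] = {X₁, X₂} := by
    simp [Matrix.range_cons, Set.pair_comm]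
  -- a nonzero multiple of `r` lies in `k[X₁, X₂]`
  obtain ⟨t, ht, ht0⟩ := Submodule.exists_mem_ne_zero_of_ne_bot
    (Ideal.comap_ne_bot_of_integral_mem (R := Algebra.adjoin k {X₁, X₂}) (I := Ideal.span {r}) hr0
      (Ideal.mem_span_singleton_self r) (Algebra.IsIntegral.isIntegral r))
  obtain ⟨a, ha⟩ := Ideal.mem_span_singleton.1 (Ideal.mem_comap.1 ht)
  obtain ⟨p, hp⟩ : (t : A) ∈ (MvPolynomial.aeval (R := k) ![X₁, X₂]).range := by
    rw [← Algebra.adjoin_range_eq_range_aeval, hrange]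
    exact t.2
  replace ha : MvPolynomial.aeval ![X₁, X₂] p = r * a := hp.trans ha
  have hp0 : p ≠ 0 := by
    rintro rfl
    exact ht0 (Subtype.ext (hp.symm.trans (map_zero _)))
  obtain ⟨d, hd⟩ : ∃ d, MvPolynomial.homogeneousComponent d p ≠ 0 := by
    by_contra! hcon
    rw [← MvPolynomial.sum_homogeneousComponent p] at hp0
    exact hp0 (Finset.sum_eq_zero fun d _ => hcon d)
  have hmem : MvPolynomial.aeval ![X₁, X₂] (MvPolynomial.homogeneousComponent d p) ∈ Q := by
    rw [aeval_homogeneousComponent 𝒜 hm _ hX, ha]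
    by_cases hle : e ≤ d * m
    · rw [DirectSum.coe_decompose_mul_of_left_mem_of_le 𝒜 hr hle]
      exact Q.mul_mem_right _ hrQ
    · rw [DirectSum.coe_decompose_mul_of_left_mem_of_not_le 𝒜 hr hle]
      exact Q.zero_mem
  obtain ⟨b, c, hbc, h0⟩ := exists_linear_relation (k := k) (Ideal.Quotient.mk Q X₁)
    (Ideal.Quotient.mk Q X₂) _ d (MvPolynomial.homogeneousComponent_isHomogeneous d p) hd (by
      rw [← Ideal.Quotient.eq_zero_iff_mem] at hmem
      rw [← hmem, ← Ideal.Quotient.mkₐ_eq_mk k, ← AlgHom.comp_apply]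
      congr 1
      ext i
      fin_cases i <;> simp)
  refine ⟨b • X₁ + c • X₂, ?_, ?_, ?_, ?_⟩
  · exact add_mem (Subalgebra.smul_mem _ (Algebra.subset_adjoin (by simp)) _)
      (Subalgebra.smul_mem _ (Algebra.subset_adjoin (by simp)) _)
  · exact add_mem (Submodule.smul_mem _ _ hX₁) (Submodule.smul_mem _ _ hX₂)
  · intro h
    have := LinearIndependent.pair_iff.1 halg.linearIndependent b c h
    tauto
  · rw [← Ideal.Quotient.eq_zero_iff_mem, ← h0]
    simp [Algebra.smul_def]

/-! ### Primes over one-dimensional primes -/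

theorem PrimesOfDim.eq_of_le {R : Type*} [CommRing R] {i : ℕ} {P P' : PrimesOfDim R i}
    (h : P.1.asIdeal ≤ P'.1.asIdeal) : P = P' := by
  refine Subtype.ext (PrimeSpectrum.ext (le_antisymm h ?_))
  by_contra hcon
  obtain ⟨x, hx', hx⟩ := SetLike.not_le_iff_exists.1 hcon
  have := ringKrullDim_quotient_add_one_le R P.1.asIdeal P'.1.asIdeal x hx h hx'
  rw [P.2, P'.2] at this
  norm_cast at this
  omega

/-- If `dim R ≤ 2`, a prime `Q` of the integral extension `A` with `dim R/(Q ∩ R) ≥ 1` is minimal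
over each of its nonzero elements `ξ`; so it is associated to `A/ξA`, and it has height one by
Krull's principal ideal theorem. -/
theorem mem_assOfHeight_of_comap {R A : Type*} [CommRing R] [CommRing A] [IsDomain A]
    [IsNoetherianRing A] [Algebra R A] [FaithfulSMul R A]
    [Algebra.IsIntegral R A] (hdim : ringKrullDim R ≤ 2) (Q : Ideal A) [Q.IsPrime]
    (hQ : 1 ≤ ringKrullDim (R ⧸ Q.comap (algebraMap R A)))
    {ξ : A} (hξ : ξ ≠ 0) (hξQ : ξ ∈ Q) : Q ∈ assOfHeight A (A ⧸ Ideal.span {ξ}) 1 := by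
  have := (FaithfulSMul.algebraMap_injective R A).isDomain
  have hmin : Q ∈ (Ideal.span {ξ}).minimalPrimes := by
    refine ⟨⟨‹_›, (Ideal.span_singleton_le_iff_mem Q).2 hξQ⟩, fun q hq hqQ => ?_⟩
    by_contra hcon
    have := hq.1
    -- otherwise `0 < q < Q` contract to a chain of primes, and `dim R > 2`
    obtain ⟨y, hy, hy'⟩ := SetLike.exists_of_lt
      (Ideal.IsIntegral.comap_lt_comap (R := R) (lt_of_le_not_ge hqQ hcon))
    obtain ⟨w, hw, hw0⟩ := Submodule.exists_mem_ne_zero_of_ne_bot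
      (Ideal.comap_ne_bot_of_integral_mem (R := R) hξ
        (hq.2 (Ideal.mem_span_singleton_self ξ)) (Algebra.IsIntegral.isIntegral ξ))
    have h1 := ringKrullDim_quotient_add_one_le R _ _ y hy' (Ideal.comap_mono hqQ) hy
    have h2 := ringKrullDim_quotient_add_one_le R (⊥ : Ideal R) _ w (by simpa using hw0) bot_le hw
    rw [ringKrullDim_eq_of_ringEquiv (RingEquiv.quotientBot R)] at h2
    have h3 : (1 : WithBot ℕ∞) + 1 + 1 ≤ 2 :=
      le_trans (by gcongr) ((add_le_add_left h1 1).trans (h2.trans hdim))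
    norm_num at h3
  refine ⟨Module.associatedPrimes.minimalPrimes_annihilator_subset_associatedPrimes A _ ?_,
    le_antisymm ?_ ?_⟩
  · rwa [Ideal.annihilator_quotient]
  · exact Ideal.height_le_one_of_isPrincipal_of_mem_minimalPrimes _ Q hmin
  · have : (⊥ : Ideal A) < Q := bot_lt_iff_ne_bot.2 (by rintro rfl; exact hξ hξQ)
    have := Ideal.height_add_one_le_of_lt_of_isPrime this
    exact le_trans le_add_self this

/-! ### Subrings containing a Noether normalization -/

theorem Subring.isNoetherianRing_of_range_algebraMap_subset {T A : Type*} [CommRing T] [CommRing A]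
    [Algebra T A] [IsNoetherianRing T] [Module.Finite T A] (R : Subring A)
    (hTR : ∀ t, algebraMap T A t ∈ R) : IsNoetherianRing R := by
  let f : T →+* R := (algebraMap T A).codRestrict R hTR
  algebraize [f]
  let g : R →ₗ[T] A :=
    { toFun r := r
      map_add' _ _ := rfl
      map_smul' t r := by
        rw [Algebra.smul_def, Algebra.smul_def]
        rfl }
  have : Module.Finite T R := Module.Finite.of_injective g Subtype.val_injective
  exact IsNoetherianRing.of_finite T R

theorem Subring.isIntegral_of_range_algebraMap_subset {T A : Type*} [CommRing T] [CommRing A]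
    [Algebra T A] [Algebra.IsIntegral T A] (R : Subring A) (hTR : ∀ t, algebraMap T A t ∈ R) :
    Algebra.IsIntegral R A :=
  ⟨RingHom.IsIntegral.tower_top ((algebraMap T A).codRestrict R hTR) (algebraMap R A)
    (algebraMap_isIntegral_iff.2 ‹_›)⟩

/-! ### Torsion of the Chow group -/

theorem theorem1p2 {k A : Type*} [Field k] [IsAlgClosed k] [CommRing A] [IsDomain A] [Algebra k A]
    (𝒜 : ℕ → Submodule k A) [GradedAlgebra 𝒜]
    -- `A` is a finitely generated `k`-algebra of dimension two with `A_0 = k`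
    (hfg : Algebra.FiniteType k A)
    (hzero : 𝒜 0 = 1)
    (hdim : ringKrullDim A = 2)
    -- `T = k[X₁, X₂]` is a Noether normalization of `A` with `deg X₁ = deg X₂ = m`
    (m : ℕ) (X₁ X₂ : A) (hX₁ : X₁ ∈ 𝒜 m) (hX₂ : X₂ ∈ 𝒜 m)
    (T : Subalgebra k A) (hT : T = Algebra.adjoin k {X₁, X₂})
    (halg : AlgebraicIndependent k ![X₁, X₂])
    (hfin : Module.Finite T A)
    -- for every nonzero `ξ ∈ T_m` there is exactly one associated prime of `A/ξA` of height one
    (hass : ∀ ξ ∈ T, ξ ∈ 𝒜 m → ξ ≠ 0 →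
      (assOfHeight A (A ⧸ Ideal.span {ξ}) 1).encard = 1)
    -- `R` is a graded ring with `T ⊆ R ⊆ A`
    (R : Subring A) (hR : DirectSum.SetLike.IsHomogeneous 𝒜 R)
    (hTR : (T : Set A) ⊆ (R : Set A)) :
    IsAddTorsion (ChowGroup R 1) := by
  subst hT
  -- `X₁` is transcendental over `k = A₀`
  have hm : m ≠ 0 := by
    rintro rfl
    rw [hzero] at hX₁
    obtain ⟨c, hc⟩ := Submodule.mem_one.1 hX₁
    refine halg.transcendental 0 ?_
    rw [Matrix.cons_val_zero, ← hc]
    exact isAlgebraic_algebraMap c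
  have hTint : Algebra.IsIntegral (Algebra.adjoin k {X₁, X₂}) A := inferInstance
  have hTnoeth : IsNoetherianRing (Algebra.adjoin k {X₁, X₂}) := by
    have : Algebra.FiniteType k (Algebra.adjoin k {X₁, X₂}) :=
      (Algebra.adjoin k {X₁, X₂}).fg_iff_finiteType.1
        (Subalgebra.fg_def.2 ⟨_, Set.toFinite _, rfl⟩)
    exact Algebra.FiniteType.isNoetherianRing k _
  have hAnoeth : IsNoetherianRing A := Algebra.FiniteType.isNoetherianRing k A
  have hRnoeth : IsNoetherianRing R :=
    R.isNoetherianRing_of_range_algebraMap_subset (T := Algebra.adjoin k {X₁, X₂}) fun t => hTR t.2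
  have hRint : Algebra.IsIntegral R A :=
    R.isIntegral_of_range_algebraMap_subset (T := Algebra.adjoin k {X₁, X₂}) fun t => hTR t.2
  have hinj : Function.Injective (algebraMap R A) := Subtype.val_injective
  have hRdim : ringKrullDim R = 2 := (ringKrullDim_eq_of_isIntegral hinj).trans hdim
  -- the zero ideal, the only prime `Q` for which the relations `div(Q, x)` are needed
  let Z : PrimesOfDim R (1 + 1) := ⟨⟨⊥, Ideal.isPrime_bot⟩, by
    rw [ringKrullDim_eq_of_ringEquiv (RingEquiv.quotientBot R), hRdim]; rfl⟩
  have hlift : ∀ P : PrimesOfDim R 1, ∃ Q : Ideal A, Q.IsPrime ∧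
      Q.comap (algebraMap R A) = P.1.asIdeal := fun P => by
    obtain ⟨Q, -, hQ, hQP⟩ := Ideal.exists_ideal_over_prime_of_isIntegral P.1.asIdeal (⊥ : Ideal A)
      (by rw [Ideal.comap_bot_of_injective _ hinj]; exact bot_le)
    exact ⟨Q, hQ, hQP⟩
  -- primes containing a nonzero homogeneous element
  have hhom : ∀ P : PrimesOfDim R 1, (∃ r ∈ P.1.asIdeal, ∃ i, (r : A) ∈ 𝒜 i ∧ r ≠ 0) →
      IsOfFinAddOrder (cycleClass R 1 (Finsupp.single P 1)) := by
    rintro P ⟨r, hrP, i, hri, hr0⟩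
    obtain ⟨Q, hQ, hQP⟩ := hlift P
    obtain ⟨ξ, hξT, hξm, hξ0, hξQ⟩ := exists_linear_form_mem 𝒜 hm hX₁ hX₂ halg Q hri
      (by simpa using hr0) (by rw [← hQP] at hrP; exact hrP)
    refine isOfFinAddOrder_single_of_mem_div Z ⟨ξ, hTR hξT⟩
      (fun h => hξ0 (congrArg Subtype.val (Ideal.mem_bot.1 h))) P bot_le (by rw [← hQP]; exact hξQ)
      fun P' hP' _ hξP' => absurd ?_ hP'
    obtain ⟨Q', hQ', hQP'⟩ := hlift P'
    obtain ⟨Q₀, hQ₀⟩ := Set.encard_eq_one.1 (hass ξ hξT hξm hξ0)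
    have h1 : Q ∈ assOfHeight A (A ⧸ Ideal.span {ξ}) 1 :=
      mem_assOfHeight_of_comap (R := R) hRdim.le Q (by rw [hQP, P.2]; rfl) hξ0 hξQ
    have h2 : Q' ∈ assOfHeight A (A ⧸ Ideal.span {ξ}) 1 :=
      mem_assOfHeight_of_comap (R := R) hRdim.le Q' (by rw [hQP', P'.2]; rfl) hξ0
        (by rw [← hQP'] at hξP'; exact hξP')
    rw [hQ₀, Set.mem_singleton_iff] at h1 h2
    exact PrimesOfDim.eq_of_le (by rw [← hQP, ← hQP', h1, h2])
  intro c
  obtain ⟨z, rfl⟩ := QuotientAddGroup.mk'_surjective (rationallyTrivial R 1) c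
  refine isOfFinAddOrder_cycleClass z fun P _ => ?_
  by_cases hP : ∃ r ∈ P.1.asIdeal, ∃ i, (r : A) ∈ 𝒜 i ∧ r ≠ 0
  · exact hhom P hP
  have hP0 : P.1.asIdeal ≠ ⊥ := by
    intro h
    have := P.2
    rw [h, Z.2] at this
    norm_num at this
  obtain ⟨f, hfP, hf0, hf⟩ := exists_mem_forall_prime_le 𝒜 R hR P.1.asIdeal hP0
  refine isOfFinAddOrder_single_of_mem_div Z f (by simpa [Z] using hf0) P bot_le hfP
    fun P' hP' _ hfP' => hhom P' ?_
  by_contra hcon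
  push Not at hcon
  exact hP' (PrimesOfDim.eq_of_le (hf P'.1.asIdeal P'.1.2 hcon hfP')).symm
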